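/- All graphs are finite and simple. A dissociation set of a graph $G$ is a set $S$ of vertices (possibly empty) such that every vertex of the induced subgraph $G[S]$ has degree at most $1$ in $G[S]$; let $d(G)$ be the number of dissociation sets of $G$. For integers $r\ge 1$ and $m\ge 0$ let $K_r\ast mK_2$ be the graph obtained from the disjoint union of $K_r$ and $m$ copies of $K_2$ by joining one fixed vertex of $K_r$ to exactly one vertex of each copy of $K_2$; let $P_6$ be the path on $6$ vertices. For $n\ge 1$ put $$f(n)=\begin{cases}2^{n-1}+(n+3)\cdot 2^{\frac{n-5}{2}}, & n \text{ odd},\\ 2^{n-1}+(n+6)\cdot 2^{\frac{n-6}{2}}, & n\text{ even}.\end{cases}$$ Theorem. Let $G$ be a connected graph of order $n\ge 1$. Then $d(G)\le f(n)$. Moreover, $d(G)=f(n)$ if and only if one of the following holds: - $n$ is odd and $G\cong K_1\ast \frac{n-1}{2}K_2$; - $n=6$ and $G\cong P_6$ or $G\cong K_2\ast 2K_2$; - $n$ is even, $n\neq 6$, and $G\cong K_2\ast \frac{n-2}{2}K_2$; - $n=3$ and $G\cong K_3$. -/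

import Mathlib

namespace Dissociation

/-- A set `S` of vertices is a dissociation set of `G` if every vertex of the induced subgraph
`G[S]` has degree at most `1` in it. -/
def IsDissociationSet {V : Type*} (G : SimpleGraph V) (S : Set V) : Prop :=
  ∀ v : S, ((G.induce S).neighborSet v).encard ≤ 1

/-- The total number of dissociation sets (the empty one included) of a finite graph. -/
noncomputable def d {V : Type*} (G : SimpleGraph V) : ℕ :=
  {S : Set V | IsDissociationSet G S}.ncard

/-- `K_r ∗ (K_{s 0} ∪ ⋯ ∪ K_{s (t-1)})`: the disjoint union of the complete graphs `K_r` and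
`K_{s i}`, where vertex `0` of `K_r` is joined to vertex `0` of each `K_{s i}`
(meant for `r` and all `s i` positive). -/
def cliqueStar (r : ℕ) {t : ℕ} (s : Fin t → ℕ) :
    SimpleGraph (Fin r ⊕ (Σ i : Fin t, Fin (s i))) where
  Adj
    | .inl a, .inl b => a ≠ b
    | .inl a, .inr q => a.val = 0 ∧ q.2.val = 0
    | .inr p, .inl b => b.val = 0 ∧ p.2.val = 0
    | .inr p, .inr q => p.1 = q.1 ∧ p ≠ q
  symm := ⟨by
    rintro (a | p) (b | q) h
    · exact h.symm
    · exact h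
    · exact h
    · exact ⟨h.1.symm, h.2.symm⟩⟩
  loopless := ⟨by
    rintro (a | p) h
    · exact h rfl
    · exact h.2 rfl⟩

/-- `K_r ∗ m K_2`. -/
def starEdges (r m : ℕ) : SimpleGraph (Fin r ⊕ (Σ _ : Fin m, Fin 2)) :=
  cliqueStar r (fun _ : Fin m => 2)

/-- The extremal value. The exponents may be negative for small `n`, and the integer divisions
by `2` are exact because of the parity of `n`. -/
def f (n : ℕ) : ℚ :=
  if Odd n then
    2 ^ ((n : ℤ) - 1) + ((n : ℚ) + 3) * 2 ^ (((n : ℤ) - 5) / 2)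
  else
    2 ^ ((n : ℤ) - 1) + ((n : ℚ) + 6) * 2 ^ (((n : ℤ) - 6) / 2)

/-- `G ≅ F_n`; for `n = 6` there are two graphs `F_n`. -/
def IsF {V : Type*} (n : ℕ) (G : SimpleGraph V) : Prop :=
  (Odd n ∧ Nonempty (G ≃g starEdges 1 ((n - 1) / 2))) ∨
  (n = 6 ∧ (Nonempty (G ≃g SimpleGraph.pathGraph 6) ∨ Nonempty (G ≃g starEdges 2 2))) ∨
  (Even n ∧ n ≠ 6 ∧ Nonempty (G ≃g starEdges 2 ((n - 2) / 2)))

end Dissociation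

/-!
Deleting edges only adds dissociation sets, so it suffices to bound `d T` for a tree `T` of order
`n ≥ 4` and to see that extremality is lost as soon as an edge is added. (All connected graphs of
order at most three are extremal.)

A vertex of `T` farthest from a root is a leaf. Either its neighbour carries a second leaf (*twins*),
or there is a *pendant edge*: `v₀`, `v₁`, `v₂` with `N(v₀) = {v₁}` and `N(v₁) = {v₀, v₂}`.

For twins `l₁`, `l₂`, rehanging `l₂` from `l₁` turns `l₂ l₁` into a pendant edge and strictly
enlarges the family of dissociation sets (`d_lt_of_twins`).

For a pendant edge (`d_le_of_pendant`) put `U = V \ {v₀, v₁}`, `W = U \ {v₂}` and let `Y` be the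
set of non-neighbours of `v₂` in `W`. Splitting according to the traces on `{v₀, v₁, v₂}` gives
`d G = 2 d(U) + 2 d(W) + d(Y)` (`dOn_pendant`). The extremal value satisfies
`F n = 2 F (n - 2) + 2 * 2 ^ (n - 3) + 2 ^ ⌊(n - 3) / 2⌋`, so, by induction applied to `U`, it is
enough to bound `2 d(W) + d(Y)` by `2 * 2 ^ (n - 3) + 2 ^ ⌊(n - 3) / 2⌋`.
* If `W` has no path on three vertices, its components have at most two vertices and each contains a
  neighbour of `v₂`. Hence `|Y| ≤ ⌊(n - 3) / 2⌋`, and equality makes `G` a spider centred at `v₂`,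
  that is, `K₁ ∗ m K₂` or `K₂ ∗ m K₂`.
* If `W` has such a path then `d(W) ≤ 7/8 * 2 ^ (n - 3)`, which is enough when `v₂` has at least two
  neighbours in `W`. When `v₂` has only one, `W` is connected and the induction hypothesis for `W`
  is enough. Equality then forces `n = 6` and `U` to be a path starting at `v₂`, so `G` is `P₆`.

Finally, if `T ≤ G` have equally many dissociation sets and `uv` is an edge of `G` only, then `u` and
`v` have the same neighbours in `T` (`d_lt_of_le`); these are twin leaves of `T`, so `T` is not
extremal.
-/

namespace Dissociation

universe u

variable {V : Type u}

/-! ### Counting dissociation sets inside a vertex set -/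

/-- `IsDissociationSet` for finite sets, in the form: no vertex of `S` has two distinct neighbours
in `S`. -/
def Diss (G : SimpleGraph V) (S : Finset V) : Prop :=
  ∀ v ∈ S, ∀ a ∈ S, ∀ b ∈ S, G.Adj v a → G.Adj v b → a = b

open Classical in
/-- The number of dissociation sets of `G` contained in `U`, that is, of `G[U]`. -/
noncomputable def dOn (G : SimpleGraph V) (U : Finset V) : ℕ :=
  (U.powerset.filter (Diss G)).card

theorem isDissociationSet_iff (G : SimpleGraph V) (S : Set V) :
    IsDissociationSet G S ↔
      ∀ v ∈ S, ∀ a ∈ S, ∀ b ∈ S, G.Adj v a → G.Adj v b → a = b := by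
  simp only [IsDissociationSet, Set.encard_le_one_iff]
  constructor
  · intro h v hv a ha b hb h1 h2
    have := h ⟨v, hv⟩ ⟨a, ha⟩ ⟨b, hb⟩ h1 h2
    simpa using this
  · rintro h ⟨v, hv⟩ ⟨a, ha⟩ ⟨b, hb⟩ h1 h2
    exact Subtype.ext (h v hv a ha b hb h1 h2)

theorem d_induce [Finite V] (G : SimpleGraph V) (U : Finset V) :
    d (G.induce (U : Set V)) = dOn G U := by
  classical
  rw [dOn, ← Set.ncard_coe_finset]
  refine Set.ncard_congr (fun S _ => (Set.toFinite (Subtype.val '' S)).toFinset) ?_ ?_ ?_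
  · intro S hS
    have hS' := (isDissociationSet_iff _ _).1 hS
    simp only [Finset.coe_filter, Finset.mem_powerset, Set.mem_ofPred_eq]
    refine ⟨?_, ?_⟩
    · intro x hx
      simp only [Set.Finite.mem_toFinset, Set.mem_image] at hx
      obtain ⟨y, _, rfl⟩ := hx
      exact y.2
    · intro v hv a ha b hb
      simp only [Set.Finite.mem_toFinset, Set.mem_image] at hv ha hb
      obtain ⟨v, hv, rfl⟩ := hv
      obtain ⟨a, ha, rfl⟩ := ha
      obtain ⟨b, hb, rfl⟩ := hb
      intro h1 h2
      exact congrArg _ (hS' v hv a ha b hb h1 h2)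
  · intro S T _ _ h
    have := congrArg (fun X : Finset V => (X : Set V)) h
    simp only [Set.Finite.coe_toFinset] at this
    exact Subtype.val_injective.image_injective this
  · intro S hS
    simp only [Finset.coe_filter, Finset.mem_powerset, Set.mem_ofPred_eq] at hS
    refine ⟨Subtype.val ⁻¹' (S : Set V), ?_, ?_⟩
    · refine (isDissociationSet_iff _ _).2 ?_
      rintro ⟨v, hv⟩ hv' ⟨a, ha⟩ ha' ⟨b, hb⟩ hb' h1 h2
      exact Subtype.ext (hS.2 v hv' a ha' b hb' h1 h2)
    · ext x
      simp only [Set.Finite.mem_toFinset, Set.mem_image, Set.mem_preimage, Finset.mem_coe,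
        Subtype.exists, exists_and_left, exists_prop, exists_eq_right_right]
      exact ⟨fun h => h.1, fun h => ⟨h, hS.1 h⟩⟩

theorem d_congr {W : Type*} {G : SimpleGraph V} {H : SimpleGraph W} (e : G ≃g H) :
    d G = d H := by
  refine Set.ncard_congr (fun S _ => e '' S) ?_ ?_ ?_
  · intro S hS
    rw [Set.mem_ofPred_eq, isDissociationSet_iff] at hS ⊢
    rintro _ ⟨v, hv, rfl⟩ _ ⟨a, ha, rfl⟩ _ ⟨b, hb, rfl⟩ h1 h2
    rw [e.map_adj_iff] at h1 h2
    rw [hS v hv a ha b hb h1 h2]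
  · intro S T _ _ h
    exact e.injective.image_injective h
  · intro S hS
    refine ⟨e ⁻¹' S, ?_, Set.image_preimage_eq _ e.surjective⟩
    rw [Set.mem_ofPred_eq, isDissociationSet_iff] at hS ⊢
    intro v hv a ha b hb h1 h2
    exact e.injective (hS _ hv _ ha _ hb (e.map_adj_iff.2 h1) (e.map_adj_iff.2 h2))

theorem d_eq_dOn_univ [Fintype V] (G : SimpleGraph V) : d G = dOn G Finset.univ := by
  rw [← d_induce, Finset.coe_univ]
  exact (d_congr (SimpleGraph.induceUnivIso G)).symm

theorem dOn_le (G : SimpleGraph V) (U : Finset V) : dOn G U ≤ 2 ^ U.card := by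
  classical
  rw [← Finset.card_powerset]
  exact Finset.card_filter_le _ _

/-- Without a path on three vertices in `U`, every subset of `U` is a dissociation set. -/
theorem dOn_eq_of_no_path (G : SimpleGraph V) (U : Finset V)
    (h : ∀ v ∈ U, ∀ a ∈ U, ∀ b ∈ U, G.Adj v a → G.Adj v b → a = b) :
    dOn G U = 2 ^ U.card := by
  classical
  rw [← Finset.card_powerset, dOn, Finset.filter_true_of_mem]
  intro S hS v hv a ha b hb
  rw [Finset.mem_powerset] at hS
  exact h v (hS hv) a (hS ha) b (hS hb)

theorem Diss.mono {G : SimpleGraph V} {S T : Finset V} (h : Diss G T) (hST : S ⊆ T) :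
    Diss G S :=
  fun v hv a ha b hb => h v (hST hv) a (hST ha) b (hST hb)

/-- A dissociation set is determined by its traces on `U` and `W`. -/
theorem dOn_union_le [DecidableEq V] (G : SimpleGraph V) (U W : Finset V) :
    dOn G (U ∪ W) ≤ dOn G U * dOn G W := by
  classical
  rw [dOn, dOn, dOn, ← Finset.card_product]
  refine Finset.card_le_card_of_injOn (fun S => (S ∩ U, S ∩ W)) ?_ ?_
  · intro S hS
    simp only [Finset.coe_filter, Finset.mem_powerset, Set.mem_ofPred_eq] at hS
    simp only [Finset.coe_product, Finset.coe_filter, Finset.mem_powerset, Set.mem_prod,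
      Set.mem_ofPred_eq]
    exact ⟨⟨Finset.inter_subset_right, hS.2.mono Finset.inter_subset_left⟩,
      ⟨Finset.inter_subset_right, hS.2.mono Finset.inter_subset_left⟩⟩
  · intro S hS T hT h
    simp only [Finset.coe_filter, Finset.mem_powerset, Set.mem_ofPred_eq] at hS hT
    simp only [Prod.mk.injEq] at h
    rw [← Finset.inter_eq_left.2 hS.1, ← Finset.inter_eq_left.2 hT.1,
      Finset.inter_union_distrib_left, Finset.inter_union_distrib_left, h.1, h.2]

/-- If `U` contains a path `a v b`, then `U` itself is not a dissociation set. -/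
theorem dOn_lt_of_path {G : SimpleGraph V} {U : Finset V} {v a b : V} (hv : v ∈ U) (ha : a ∈ U)
    (hb : b ∈ U) (h1 : G.Adj v a) (h2 : G.Adj v b) (hab : a ≠ b) : dOn G U < 2 ^ U.card := by
  classical
  rw [← Finset.card_powerset, dOn]
  refine Finset.card_lt_card ⟨Finset.filter_subset _ _, fun h => ?_⟩
  exact hab ((Finset.mem_filter.1 (h (Finset.mem_powerset_self U))).2 v hv a ha b hb h1 h2)

/-- At most `7` of the `8` traces on a path with three vertices are possible. -/
theorem eight_mul_dOn_le_of_path {G : SimpleGraph V} {U : Finset V} {v a b : V} (hv : v ∈ U)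
    (ha : a ∈ U) (hb : b ∈ U) (h1 : G.Adj v a) (h2 : G.Adj v b) (hab : a ≠ b) :
    8 * dOn G U ≤ 7 * 2 ^ U.card := by
  classical
  have hc : ({v, a, b} : Finset V).card = 3 :=
    Finset.card_eq_three.2 ⟨v, a, b, h1.ne, h2.ne, hab, rfl⟩
  have hsub : ({v, a, b} : Finset V) ⊆ U := by
    intro x
    simp only [Finset.mem_insert, Finset.mem_singleton]
    rintro (rfl | rfl | rfl) <;> assumption
  have h3 : dOn G {v, a, b} < 8 := by
    have := dOn_lt_of_path (U := {v, a, b}) (by simp) (by simp) (by simp) h1 h2 hab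
    rwa [hc] at this
  have h4 := dOn_union_le G {v, a, b} (U \ {v, a, b})
  rw [Finset.union_sdiff_of_subset hsub] at h4
  have h5 := dOn_le G (U \ {v, a, b})
  have h6 := Finset.card_sdiff_add_card_eq_card hsub
  rw [hc] at h6
  rw [← h6, pow_add]
  have := Nat.mul_le_mul (Nat.le_of_lt_succ h3) h5
  omega

open Classical in
theorem card_filter_powerset_insert (P : Finset V → Prop) {v : V} {U : Finset V} (hv : v ∉ U) :
    ((insert v U).powerset.filter P).card =
      (U.powerset.filter P).card + (U.powerset.filter fun S => P (insert v S)).card := by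
  rw [Finset.powerset_insert, Finset.filter_union, Finset.card_union_of_disjoint,
    Finset.filter_image, Finset.card_image_of_injOn]
  · intro S hS T hT h
    simp only [Finset.coe_filter, Finset.mem_powerset, Set.mem_ofPred_eq] at hS hT
    have h1 : v ∉ S := fun h => hv (hS.1 h)
    have h2 : v ∉ T := fun h => hv (hT.1 h)
    rw [← Finset.erase_insert h1, ← Finset.erase_insert h2]
    exact congrArg (fun X => Finset.erase X v) h
  · rw [Finset.disjoint_left]
    intro S hS hS'
    simp only [Finset.mem_filter, Finset.mem_powerset, Finset.mem_image] at hS hS'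
    obtain ⟨⟨T, _, rfl⟩, _⟩ := hS'
    exact hv (hS.1 (Finset.mem_insert_self _ _))


open Classical in
/-- The recursion at a pendant edge `v₀ v₁` attached to `v₂`. Of the eight traces on
`{v₀, v₁, v₂}`, the four without `v₂` leave an arbitrary dissociation set of `W`; `{v₂}` and
`{v₀, v₂}` leave the condition that adding `v₂` preserves dissociation; `{v₁, v₂}` excludes the
neighbours of `v₂`; and the full trace is impossible. -/
theorem dOn_pendant {G : SimpleGraph V} {v₀ v₁ v₂ : V} {W : Finset V}
    (h01 : v₀ ≠ v₁) (h02 : v₀ ≠ v₂) (h12 : v₁ ≠ v₂) (h0W : v₀ ∉ W) (h1W : v₁ ∉ W) (h2W : v₂ ∉ W)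
    (a01 : G.Adj v₀ v₁) (a12 : G.Adj v₁ v₂) (a02 : ¬ G.Adj v₀ v₂)
    (a0 : ∀ x ∈ W, ¬ G.Adj v₀ x) (a1 : ∀ x ∈ W, ¬ G.Adj v₁ x) :
    dOn G (insert v₀ (insert v₁ (insert v₂ W))) =
      2 * dOn G (insert v₂ W) + 2 * dOn G W + dOn G (W.filter fun x => ¬ G.Adj v₂ x) := by
  have key : ∀ (P Q : Finset V → Prop), (∀ S, S ⊆ W → (P S ↔ Q S)) →
      (W.powerset.filter P).card = (W.powerset.filter Q).card := by
    intro P Q h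
    congr 1
    apply Finset.filter_congr
    intro S hS
    exact h S (Finset.mem_powerset.1 hS)
  have s10 := a01.symm
  have s21 := a12.symm
  have s20 : ¬ G.Adj v₂ v₀ := fun h => a02 h.symm
  have s0 : ∀ x ∈ W, ¬ G.Adj x v₀ := fun x hx h => a0 x hx h.symm
  have s1 : ∀ x ∈ W, ¬ G.Adj x v₁ := fun x hx h => a1 x hx h.symm
  have l0 := G.irrefl (v := v₀)
  have l1 := G.irrefl (v := v₁)
  have l2 := G.irrefl (v := v₂)
  -- The trace `{v₁, v₂}`: `v₂` already has the neighbour `v₁`, so none in `W` is allowed.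
  have hY : dOn G (W.filter fun x => ¬ G.Adj v₂ x) =
      (W.powerset.filter fun S => Diss G (insert v₁ (insert v₂ S))).card := by
    rw [dOn]
    congr 1
    ext S
    simp only [Finset.mem_filter, Finset.mem_powerset]
    constructor
    · rintro ⟨hS, hD⟩
      have hS' : ∀ x ∈ S, x ∈ W ∧ ¬ G.Adj v₂ x ∧ ¬ G.Adj x v₂ := fun x hx =>
        have := Finset.mem_filter.1 (hS hx)
        ⟨this.1, this.2, fun h => this.2 h.symm⟩
      refine ⟨fun x hx => (hS' x hx).1, ?_⟩
      simp only [Diss, Finset.mem_insert] at hD ⊢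
      grind
    · rintro ⟨hS, hD⟩
      have hD' : Diss G S := hD.mono (by grind)
      refine ⟨fun x hx => Finset.mem_filter.2 ⟨hS hx, fun h => ?_⟩, hD'⟩
      have := hD v₂ (by simp) v₁ (by simp) x (by simp [hx]) s21 h
      exact h1W (this ▸ hS hx)
  have e1 : ∀ S : Finset V, S ⊆ W → (Diss G (insert v₀ S) ↔ Diss G S) := by
    intro S hS
    refine ⟨fun h => h.mono (Finset.subset_insert _ _), fun h => ?_⟩
    simp only [Diss, Finset.mem_insert] at h ⊢
    grind
  have e2 : ∀ S : Finset V, S ⊆ W → (Diss G (insert v₁ S) ↔ Diss G S) := by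
    intro S hS
    refine ⟨fun h => h.mono (Finset.subset_insert _ _), fun h => ?_⟩
    simp only [Diss, Finset.mem_insert] at h ⊢
    grind
  have e3 : ∀ S : Finset V, S ⊆ W → (Diss G (insert v₀ (insert v₁ S)) ↔ Diss G S) := by
    intro S hS
    refine ⟨fun h => h.mono (by grind), fun h => ?_⟩
    simp only [Diss, Finset.mem_insert] at h ⊢
    grind
  have e4 : ∀ S : Finset V, S ⊆ W →
      (Diss G (insert v₀ (insert v₂ S)) ↔ Diss G (insert v₂ S)) := by
    intro S hS
    refine ⟨fun h => h.mono (by grind), fun h => ?_⟩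
    simp only [Diss, Finset.mem_insert] at h ⊢
    grind
  have e5 : ∀ S : Finset V, ¬ Diss G (insert v₀ (insert v₁ (insert v₂ S))) := by
    intro S h
    exact h02 (h v₁ (by simp) v₀ (by simp) v₂ (by simp) s10 a12)
  rw [hY]
  simp only [dOn]
  rw [card_filter_powerset_insert _ (by grind), card_filter_powerset_insert _ (by grind),
    card_filter_powerset_insert _ (by grind), card_filter_powerset_insert _ (by grind),
    card_filter_powerset_insert _ (by grind), card_filter_powerset_insert _ (by grind),
    card_filter_powerset_insert _ (by grind),
    key _ _ e1, key _ _ e2, key _ _ e3, key _ _ e4,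
    key (fun S => Diss G (insert v₀ (insert v₁ (insert v₂ S)))) (fun _ => False)
      (fun S _ => iff_false_intro (e5 S))]
  simp only [Finset.filter_false, Finset.card_empty]
  ring

/-! ### The extremal value -/

/-- The extremal value `f n` for `n ≥ 1`, as a natural number and by the recursion that it inherits
from `dOn_pendant`. The value at `0` is irrelevant. -/
def maxCount : ℕ → ℕ
  | 0 => 1
  | 1 => 2
  | 2 => 4
  | n + 3 => 2 * maxCount (n + 1) + 2 * 2 ^ n + 2 ^ (n / 2)

/-- Doubled, so that the power `2 ^ (k - 1)` of the closed form stays natural for `k = 0`. -/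
theorem two_mul_maxCount_odd (k : ℕ) :
    2 * maxCount (2 * k + 1) = 2 * 2 ^ (2 * k) + (k + 2) * 2 ^ k := by
  induction k with
  | zero => rfl
  | succ k ih =>
    rw [show 2 * (k + 1) + 1 = 2 * k + 3 by ring, maxCount, Nat.mul_add, Nat.mul_add, ih,
      show 2 * k / 2 = k by omega]
    ring

theorem two_mul_maxCount_even (k : ℕ) :
    2 * maxCount (2 * k + 2) = 2 * 2 ^ (2 * k + 1) + (k + 4) * 2 ^ k := by
  induction k with
  | zero => rfl
  | succ k ih =>
    rw [show 2 * (k + 1) + 2 = 2 * k + 1 + 3 by ring, maxCount, Nat.mul_add, Nat.mul_add, ih,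
      show (2 * k + 1) / 2 = k by omega]
    ring

theorem maxCount_eq_f {n : ℕ} (hn : 1 ≤ n) : (maxCount n : ℚ) = f n := by
  obtain ⟨k, rfl | rfl⟩ : ∃ k, n = 2 * k + 1 ∨ n = 2 * k + 2 := ⟨(n - 1) / 2, by omega⟩
  · have h : (2 : ℚ) * maxCount (2 * k + 1) = 2 * 2 ^ (2 * k) + (k + 2) * 2 ^ k := by
      exact_mod_cast two_mul_maxCount_odd k
    have e1 : ((2 * k + 1 : ℕ) : ℤ) - 1 = (2 * k : ℕ) := by push_cast; ring
    have e2 : (((2 * k + 1 : ℕ) : ℤ) - 5) / 2 = (k : ℤ) - 2 := by omega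
    rw [f, if_pos ⟨k, rfl⟩, e1, e2, zpow_natCast, zpow_sub₀ two_ne_zero, zpow_natCast]
    push_cast
    linarith
  · have h : (2 : ℚ) * maxCount (2 * k + 2) = 2 * 2 ^ (2 * k + 1) + (k + 4) * 2 ^ k := by
      exact_mod_cast two_mul_maxCount_even k
    have e1 : ((2 * k + 2 : ℕ) : ℤ) - 1 = (2 * k + 1 : ℕ) := by push_cast; ring
    have e2 : (((2 * k + 2 : ℕ) : ℤ) - 6) / 2 = (k : ℤ) - 2 := by omega
    rw [f, if_neg (by rw [Nat.not_odd_iff_even]; exact ⟨k + 1, by ring⟩), e1, e2, zpow_natCast,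
      zpow_sub₀ two_ne_zero, zpow_natCast]
    push_cast
    linarith

/-- The numerical reason why a vertex `v₂` of degree one in `U`, followed by a path on three vertices,
is never extremal for `|W| ≥ 4`. -/
theorem two_mul_maxCount_lt (k : ℕ) :
    2 * maxCount (k + 4) < 3 * 2 ^ (k + 3) + 2 ^ ((k + 4) / 2) := by
  induction k using Nat.twoStepInduction with
  | zero => decide
  | one => decide
  | more k ih _ =>
    rw [show k + 2 + 4 = (k + 3) + 3 by ring, maxCount]
    have h1 : 2 ^ ((k + 3) / 2) ≤ 2 ^ (k + 3) := Nat.pow_le_pow_right two_pos (by omega)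
    have h2 : 2 ^ ((k + 3 + 3) / 2) = 2 * 2 ^ ((k + 4) / 2) := by
      rw [show (k + 3 + 3) / 2 = (k + 4) / 2 + 1 by omega, pow_succ, mul_comm]
    have h3 : 2 ^ (k + 2 + 3) = 4 * 2 ^ (k + 3) := by ring
    rw [h2, h3]
    change 2 * (2 * maxCount (k + 4) + _ + _) < _
    omega

/-! ### Spiders -/

theorem dOn_eq_of_card_le_two (G : SimpleGraph V) {U : Finset V} (h : U.card ≤ 2) :
    dOn G U = 2 ^ U.card := by
  classical
  refine dOn_eq_of_no_path G U fun v hv a ha b hb h1 h2 => ?_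
  by_contra hab
  have h3 : ({v, a, b} : Finset V).card = 3 :=
    Finset.card_eq_three.2 ⟨v, a, b, h1.ne, h2.ne, hab, rfl⟩
  have := Finset.card_le_card (show ({v, a, b} : Finset V) ⊆ U by grind)
  omega

open Classical in
/-- The feet of `c` in `U`: the vertices of `U` other than `c` that are not adjacent to `c`. -/
noncomputable def feet (G : SimpleGraph V) (U : Finset V) (c : V) : Finset V :=
  U.filter fun x => x ≠ c ∧ ¬ G.Adj c x

theorem mem_feet {G : SimpleGraph V} {U : Finset V} {c x : V} :
    x ∈ feet G U c ↔ x ∈ U ∧ x ≠ c ∧ ¬ G.Adj c x := by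
  simp [feet]

/-- `G[U]` is a spider with centre `c`: the graph `G[U] - c` has maximum degree at most one, and each
foot is adjacent to a neighbour of `c` (its knee). A component of `G[U] - c` may consist of two
neighbours of `c`; prescribing the number of feet excludes this. -/
structure IsSpider (G : SimpleGraph V) (U : Finset V) (c : V) : Prop where
  center_mem : c ∈ U
  no_path : ∀ v ∈ U, ∀ a ∈ U, ∀ b ∈ U, v ≠ c → a ≠ c → b ≠ c → G.Adj v a → G.Adj v b → a = b
  exists_knee : ∀ x ∈ feet G U c, ∃ a ∈ U, G.Adj x a ∧ G.Adj c a

/-- Distinct feet have distinct knees. -/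
theorem IsSpider.exists_knee_map {G : SimpleGraph V} {U : Finset V} {c : V}
    (h : IsSpider G U c) : ∃ p : V → V, Set.InjOn p (feet G U c) ∧
      ∀ x ∈ feet G U c, p x ∈ U ∧ G.Adj x (p x) ∧ G.Adj c (p x) := by
  classical
  choose! p hp using h.exists_knee
  refine ⟨p, ?_, hp⟩
  intro x hx y hy hxy
  rw [Finset.mem_coe] at hx hy
  obtain ⟨h1, h2, h3⟩ := hp x hx
  obtain ⟨h4, h5, h6⟩ := hp y hy
  rw [mem_feet] at hx hy
  exact h.no_path (p x) h1 x hx.1 y hy.1 h3.ne' hx.2.1 hy.2.1 h2.symm (hxy ▸ h5.symm)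

open Classical in
theorem card_feet_add (G : SimpleGraph V) {U : Finset V} {c : V} (hc : c ∈ U) :
    (feet G U c).card + (U.filter fun x => G.Adj c x).card + 1 = U.card := by
  rw [← Finset.card_erase_add_one hc, feet,
    ← Finset.card_filter_add_card_filter_not (s := U.erase c) (fun x => G.Adj c x)]
  have e1 : U.filter (fun x => x ≠ c ∧ ¬ G.Adj c x) = (U.erase c).filter fun x => ¬ G.Adj c x := by
    grind
  have e2 : U.filter (fun x => G.Adj c x) = (U.erase c).filter fun x => G.Adj c x := by
    ext x
    simp only [Finset.mem_filter, Finset.mem_erase]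
    exact ⟨fun h => ⟨⟨h.2.ne', h.1⟩, h.2⟩, fun h => ⟨h.1.2, h.2⟩⟩
  rw [e1, e2]
  omega

theorem IsSpider.two_mul_card_feet_lt {G : SimpleGraph V} {U : Finset V} {c : V}
    (h : IsSpider G U c) : 2 * (feet G U c).card < U.card := by
  classical
  obtain ⟨p, hp, hp'⟩ := h.exists_knee_map
  have h1 := card_feet_add G h.center_mem
  have h2 : (feet G U c).card ≤ (U.filter fun x => G.Adj c x).card := by
    refine Finset.card_le_card_of_injOn p (fun x hx => ?_) hp
    have := hp' x hx
    simp [this.1, this.2.2]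
  omega

/-- A spider with as many feet as its order permits attains the extremal value; the feet are removed
one at a time, together with their knees, by `dOn_pendant`. -/
theorem IsSpider.dOn_eq {G : SimpleGraph V} {U : Finset V} {c : V}
    (h : IsSpider G U c) (hf : (feet G U c).card = (U.card - 1) / 2) :
    dOn G U = maxCount U.card := by
  classical
  induction hn : U.card using Nat.strong_induction_on generalizing U with
  | _ n ih =>
  match n, hn, ih with
  | 0, hn, _ => exact absurd h.center_mem (by simp [Finset.card_eq_zero.1 hn])
  | 1, hn, _ => rw [dOn_eq_of_card_le_two G (by omega), hn]; rfl
  | 2, hn, _ => rw [dOn_eq_of_card_le_two G (by omega), hn]; rfl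
  | n + 3, hn, ih =>
    obtain ⟨b, hb⟩ : (feet G U c).Nonempty := Finset.card_pos.1 (by omega)
    obtain ⟨a, haU, hba, hca⟩ := h.exists_knee b hb
    have hb' := mem_feet.1 hb
    have hcU := h.center_mem
    have nb : ∀ x ∈ U, G.Adj b x → x = a := fun x hx hbx =>
      h.no_path b hb'.1 x hx a haU hb'.2.1 (fun e => hb'.2.2 (e ▸ hbx).symm) hca.ne' hbx hba
    have na : ∀ x ∈ U, x ≠ c → G.Adj a x → x = b := fun x hx hxc hax =>
      h.no_path a haU x hx b hb'.1 hca.ne' hxc hb'.2.1 hax hba.symm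
    set W := ((U.erase b).erase a).erase c with hW
    have hcW : insert c W = (U.erase b).erase a := by
      rw [hW, Finset.insert_erase]; grind [hca.ne]
    have hU : U = insert b (insert a (insert c W)) := by
      rw [hcW, Finset.insert_erase (by grind [hba.ne]), Finset.insert_erase hb'.1]
    have hWU : ∀ x ∈ W, x ∈ U ∧ x ≠ a ∧ x ≠ b ∧ x ≠ c := by grind
    have hWc : W.card = n := by
      rw [hW, Finset.card_erase_of_mem (by grind [hca.ne]),
        Finset.card_erase_of_mem (by grind [hba.ne]), Finset.card_erase_of_mem hb'.1]
      omega
    have hcWc : (insert c W).card = n + 1 := by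
      rw [Finset.card_insert_of_notMem (by grind), hWc]
    have hfeet : feet G (insert c W) c = (feet G U c).erase b := by
      ext x
      simp only [mem_feet, Finset.mem_erase, hcW]
      grind
    have hfc : (feet G (insert c W) c).card = n / 2 := by
      rw [hfeet, Finset.card_erase_of_mem hb]
      omega
    have hY : W.filter (fun x => ¬ G.Adj c x) = feet G (insert c W) c := by
      ext x
      simp only [mem_feet, Finset.mem_filter, Finset.mem_insert]
      grind
    have hs : IsSpider G (insert c W) c := by
      refine ⟨by simp, fun v hv x hx y hy => ?_, fun x hx => ?_⟩
      · exact h.no_path v (by grind) x (by grind) y (by grind)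
      · have hx' : x ∈ feet G U c := by grind
        obtain ⟨z, hz, h1, h2⟩ := h.exists_knee x hx'
        refine ⟨z, ?_, h1, h2⟩
        have : z ≠ a := by
          rintro rfl
          have := na x (mem_feet.1 hx').1 (mem_feet.1 hx').2.1 h1.symm
          grind
        have : z ≠ b := by
          rintro rfl
          exact hb'.2.2 h2
        grind
    have hno : ∀ v ∈ W, ∀ x ∈ W, ∀ y ∈ W, G.Adj v x → G.Adj v y → x = y :=
      fun v hv x hx y hy => h.no_path v (hWU v hv).1 x (hWU x hx).1 y (hWU y hy).1
        (hWU v hv).2.2.2 (hWU x hx).2.2.2 (hWU y hy).2.2.2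
    rw [hU, dOn_pendant hba.ne hb'.2.1 hca.ne' (by grind) (by grind) (by grind) hba hca.symm
      (fun e => hb'.2.2 e.symm) (fun x hx e => (hWU x hx).2.1 (nb x (hWU x hx).1 e))
      (fun x hx e => (hWU x hx).2.2.1 (na x (hWU x hx).1 (hWU x hx).2.2.2 e)),
      ih (n + 1) (by omega) hs (by rw [hcWc, hfc]; rfl) hcWc, dOn_eq_of_no_path G W hno,
      dOn_eq_of_no_path G (W.filter _) (fun v hv x hx y hy => hno v (Finset.mem_filter.1 hv).1
        x (Finset.mem_filter.1 hx).1 y (Finset.mem_filter.1 hy).1), hWc, hY, hfc, maxCount]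

/-- A spider of order `r + 2 m` with `m` feet, `r ∈ {1, 2}`, is `K_r ∗ m K_2`. -/
theorem IsSpider.nonempty_iso [Fintype V] {G : SimpleGraph V} {c : V}
    (h : IsSpider G Finset.univ c) {r m : ℕ} (hm : (feet G Finset.univ c).card = m)
    (hr : r = 1 ∨ r = 2) (hV : Fintype.card V = r + 2 * m) : Nonempty (G ≃g starEdges r m) := by
  classical
  obtain ⟨p, hp, hp'⟩ := h.exists_knee_map
  let e : Fin m ≃ feet G Finset.univ c := (finCongr hm.symm).trans (Finset.equivFin _).symm
  -- `q` embeds `K_r`: it sends `0` to the centre and, if `r = 2`, `1` to the neighbour of the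
  -- centre that is not a knee.
  obtain ⟨q, hq0, hq1⟩ : ∃ q : Fin r → V, (∀ j, j.val = 0 → q j = c) ∧ ∀ j, j.val ≠ 0 →
      G.Adj c (q j) ∧ q j ∉ (feet G Finset.univ c).image p := by
    rcases hr with rfl | rfl
    · exact ⟨fun _ => c, by simp, by simp⟩
    · have h1 := card_feet_add G h.center_mem
      rw [Finset.card_univ] at h1
      have h2 := Finset.card_image_of_injOn hp
      obtain ⟨x, hx, hx'⟩ := Finset.exists_mem_notMem_of_card_lt_card
        (s := (feet G Finset.univ c).image p) (t := Finset.univ.filter fun x => G.Adj c x) (by omega)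
      refine ⟨![c, x], ?_, ?_⟩
      · intro j hj
        obtain rfl : j = 0 := Fin.ext hj
        rfl
      · intro j hj
        obtain rfl : j = 1 := Fin.ext (by have := j.2; simp; omega)
        exact ⟨by simpa using hx, hx'⟩
  have hb : ∀ i, (e i : V) ≠ c ∧ ¬ G.Adj c (e i) := fun i => (mem_feet.1 (e i).2).2
  have ha : ∀ i, G.Adj (e i) (p (e i)) ∧ G.Adj c (p (e i)) := fun i => (hp' _ (e i).2).2
  have hnp : ∀ v a b : V, v ≠ c → a ≠ c → b ≠ c → G.Adj v a → G.Adj v b → a = b :=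
    fun v a b => h.no_path v (by simp) a (by simp) b (by simp)
  have hpi : ∀ i k, p (e i) = p (e k) → i = k := fun i k hik =>
    e.injective (Subtype.ext (hp (e i).2 (e k).2 hik))
  have hei : ∀ i k, (e i : V) = e k → i = k := fun i k hik => e.injective (Subtype.ext hik)
  have hqi : ∀ j, j.val ≠ 0 → ∀ i, q j ≠ p (e i) := fun j hj i hji =>
    (hq1 j hj).2 (Finset.mem_image.2 ⟨e i, (e i).2, hji.symm⟩)
  let φ : Fin r ⊕ (Σ _ : Fin m, Fin 2) → V :=
    Sum.elim q fun s => if s.2 = 0 then p (e s.1) else e s.1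
  have two : ∀ s : Fin 2, s = 0 ∨ s = 1 := by decide
  have hqq : ∀ j k : Fin r, j.val ≠ 0 → k.val ≠ 0 → j = k := fun j k hj hk =>
    Fin.ext (by omega)
  have hpc : ∀ i x, x ≠ c → G.Adj (p (e i)) x → x = e i := fun i x hx hpx =>
    hnp _ x (e i) (ha i).2.ne' hx (hb i).1 hpx (ha i).1.symm
  have hec : ∀ i x, G.Adj (e i) x → x = p (e i) := fun i x hex =>
    hnp _ x _ (hb i).1 (fun h => (hb i).2 (h ▸ hex).symm) (ha i).2.ne' hex (ha i).1
  have hq_ne : ∀ (j : Fin r) (l : Fin m) (t : Fin 2), q j ≠ φ (.inr ⟨l, t⟩) := by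
    intro j l t h
    by_cases hj : j.val = 0
    · rw [hq0 j hj] at h
      rcases two t with rfl | rfl
      · exact (ha l).2.ne h
      · exact (hb l).1 h.symm
    · rcases two t with rfl | rfl
      · exact hqi j hj l h
      · exact (hb l).2 ((show q j = e l from h) ▸ (hq1 j hj).1)
  have hinj : Function.Injective φ := by
    rintro (j | ⟨i, s⟩) (k | ⟨l, t⟩) hxy
    · by_cases hj : j.val = 0 <;> by_cases hk : k.val = 0
      · exact congrArg _ (Fin.ext (hj.trans hk.symm))
      · exact absurd (((hq0 j hj).symm.trans hxy)) (hq1 k hk).1.ne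
      · exact absurd ((hxy.trans (hq0 k hk)).symm) (hq1 j hj).1.ne
      · exact congrArg _ (hqq j k hj hk)
    · exact absurd hxy (hq_ne j l t)
    · exact absurd hxy.symm (hq_ne k i s)
    · rcases two s with rfl | rfl <;> rcases two t with rfl | rfl
      · rw [hpi i l hxy]
      · exact absurd (ha i).2 (by rw [show p (e i) = e l from hxy]; exact (hb l).2)
      · exact absurd (ha l).2 (by rw [show p (e l) = e i from hxy.symm]; exact (hb i).2)
      · rw [hei i l hxy]
  have hadj : ∀ x y, (starEdges r m).Adj x y → G.Adj (φ x) (φ y) := by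
    rintro (j | ⟨i, s⟩) (k | ⟨l, t⟩) h
    · by_cases hj : j.val = 0 <;> by_cases hk : k.val = 0
      · exact absurd (Fin.ext (hj.trans hk.symm)) h
      · exact show G.Adj (q j) (q k) by rw [hq0 j hj]; exact (hq1 k hk).1
      · exact show G.Adj (q j) (q k) by rw [hq0 k hk]; exact (hq1 j hj).1.symm
      · exact absurd (hqq j k hj hk) h
    · obtain ⟨hj, ht⟩ := h
      obtain rfl : t = 0 := Fin.ext ht
      exact show G.Adj (q j) (p (e l)) by rw [hq0 j hj]; exact (ha l).2
    · obtain ⟨hj, ht⟩ := h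
      obtain rfl : s = 0 := Fin.ext ht
      exact show G.Adj (p (e i)) (q k) by rw [hq0 k hj]; exact (ha i).2.symm
    · obtain ⟨h1, h2⟩ := h
      dsimp only at h1
      subst h1
      rcases two s with rfl | rfl <;> rcases two t with rfl | rfl
      · exact absurd rfl h2
      · exact (ha i).1.symm
      · exact (ha i).1
      · exact absurd rfl h2
  have hmix : ∀ (j : Fin r) (l : Fin m) (t : Fin 2), G.Adj (q j) (φ (.inr ⟨l, t⟩)) →
      j.val = 0 ∧ t.val = 0 := by
    intro j l t h
    by_cases hj : j.val = 0
    · refine ⟨hj, ?_⟩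
      rcases two t with rfl | rfl
      · rfl
      · rw [hq0 j hj] at h
        exact absurd h (hb l).2
    · rcases two t with rfl | rfl
      · have := hpc l (q j) (hq1 j hj).1.ne' h.symm
        exact absurd (hq1 j hj).1 (this ▸ (hb l).2)
      · exact absurd (hec l (q j) h.symm) (hqi j hj l)
  have hadj' : ∀ x y, G.Adj (φ x) (φ y) → (starEdges r m).Adj x y := by
    rintro (j | ⟨i, s⟩) (k | ⟨l, t⟩) h
    · rintro rfl
      exact G.irrefl h
    · exact hmix j l t h
    · exact hmix k i s h.symm
    · refine ⟨?_, fun hne => G.irrefl (hne ▸ h)⟩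
      rcases two s with rfl | rfl <;> rcases two t with rfl | rfl
      · have := hpc i (p (e l)) (ha l).2.ne' h
        exact absurd (ha l).2 (this ▸ (hb i).2)
      · exact (hei _ _ (hpc i (e l) (hb l).1 h)).symm
      · exact (hei _ _ (hpc l (e i) (hb i).1 h.symm))
      · have := hec i (e l) h
        exact absurd (ha i).2 (this ▸ (hb l).2)
  have hbij : Function.Bijective φ := by
    rw [Fintype.bijective_iff_injective_and_card]
    refine ⟨hinj, ?_⟩
    simp [hV]
    ring
  exact ⟨(⟨Equiv.ofBijective φ hbij, fun {x y} => ⟨hadj' x y, hadj x y⟩⟩ : starEdges r m ≃g G).symm⟩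

theorem isSpider_starEdges {r m : ℕ} (hr : 0 < r) (hr2 : r ≤ 2) :
    IsSpider (starEdges r m) Finset.univ (Sum.inl ⟨0, hr⟩) ∧
      (feet (starEdges r m) Finset.univ (Sum.inl ⟨0, hr⟩)).card = m := by
  classical
  have two : ∀ s : Fin 2, s = 0 ∨ s = 1 := by decide
  have hfeet : feet (starEdges r m) Finset.univ (Sum.inl ⟨0, hr⟩) =
      Finset.univ.image fun i : Fin m => Sum.inr ⟨i, 1⟩ := by
    ext x
    rw [mem_feet]
    rcases x with j | ⟨i, s⟩
    · simp [starEdges, cliqueStar, eq_comm]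
    · rcases two s with rfl | rfl <;> simp [starEdges, cliqueStar]
  refine ⟨⟨Finset.mem_univ _, ?_, ?_⟩, ?_⟩
  · have hz : ∀ j : Fin r, (Sum.inl j : Fin r ⊕ (Σ _ : Fin m, Fin 2)) ≠ Sum.inl ⟨0, hr⟩ →
        j.val = 1 := by
      intro j hj
      have : j.val ≠ 0 := fun h => hj (congrArg _ (Fin.ext h))
      omega
    rintro (v | ⟨v, v'⟩) - (a | ⟨a, a'⟩) - (b | ⟨b, b'⟩) - hv ha hb h1 h2
    · exact absurd (Fin.ext ((hz v hv).trans (hz a ha).symm)) h1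
    · exact absurd (Fin.ext ((hz v hv).trans (hz a ha).symm)) h1
    · exact absurd (Fin.ext ((hz v hv).trans (hz b hb).symm)) h2
    · exact absurd h1.1 (by simp [hz v hv])
    · exact absurd h1.1 (by simp [hz a ha])
    · exact absurd h1.1 (by simp [hz a ha])
    · exact absurd h2.1 (by simp [hz b hb])
    · obtain ⟨h3, h4⟩ := h1
      obtain ⟨h5, h6⟩ := h2
      dsimp only at h3 h5
      subst h3 h5
      rcases two v' with rfl | rfl <;> rcases two a' with rfl | rfl <;>
        rcases two b' with rfl | rfl <;> simp_all
  · intro x hx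
    rw [hfeet, Finset.mem_image] at hx
    obtain ⟨i, -, rfl⟩ := hx
    exact ⟨Sum.inr ⟨i, 0⟩, Finset.mem_univ _, ⟨rfl, by simp⟩, ⟨rfl, rfl⟩⟩
  · rw [hfeet, Finset.card_image_of_injective, Finset.card_univ, Fintype.card_fin]
    intro i k hik
    simpa using hik

theorem d_starEdges {r m : ℕ} (hr : 0 < r) (hr2 : r ≤ 2) :
    d (starEdges r m) = maxCount (r + 2 * m) := by
  obtain ⟨h1, h2⟩ := isSpider_starEdges (m := m) hr hr2
  have hc : (Finset.univ : Finset (Fin r ⊕ (Σ _ : Fin m, Fin 2))).card = r + 2 * m := by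
    simp; ring
  rw [d_eq_dOn_univ, h1.dOn_eq (by rw [h2, hc]; omega), hc]

theorem isF_of_isSpider [Fintype V] {G : SimpleGraph V} {c : V} {n : ℕ}
    (hn : Fintype.card V = n) (h : IsSpider G Finset.univ c)
    (hf : (feet G Finset.univ c).card = (n - 1) / 2) : IsF n G := by
  have : 0 < n := hn ▸ Fintype.card_pos_iff.2 ⟨c⟩
  rcases Nat.even_or_odd n with he | ho
  · obtain ⟨k, hk⟩ := he
    have := h.nonempty_iso (r := 2) (m := (n - 2) / 2) (by omega) (by simp) (by omega)
    by_cases h6 : n = 6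
    · subst h6
      exact Or.inr (Or.inl ⟨rfl, Or.inr this⟩)
    · exact Or.inr (Or.inr ⟨⟨k, hk⟩, h6, this⟩)
  · obtain ⟨k, hk⟩ := id ho
    exact Or.inl ⟨ho, h.nonempty_iso hf (by simp) (by omega)⟩

theorem d_pathGraph_six : d (SimpleGraph.pathGraph 6) = maxCount 6 := by
  classical
  have hadj : ∀ i j : Fin 6, (SimpleGraph.pathGraph 6).Adj i j ↔
      i.val + 1 = j.val ∨ j.val + 1 = i.val := fun i j => SimpleGraph.pathGraph_adj
  have : (Finset.univ.powerset.filter fun S : Finset (Fin 6) => ∀ v ∈ S, ∀ a ∈ S, ∀ b ∈ S,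
      (v.val + 1 = a.val ∨ a.val + 1 = v.val) → (v.val + 1 = b.val ∨ b.val + 1 = v.val) →
        a = b).card = 44 := by
    decide +kernel
  rw [d_eq_dOn_univ, dOn, show maxCount 6 = 44 from rfl, ← this]
  congr 1
  ext S
  simp only [Finset.mem_filter, Diss, hadj]

theorem d_of_isF [Fintype V] {G : SimpleGraph V} {n : ℕ}
    (hn : Fintype.card V = n) (hn0 : 0 < n) (h : IsF n G) : d G = maxCount n := by
  rcases h with ⟨⟨k, hk⟩, ⟨e⟩⟩ | ⟨rfl, ⟨⟨e⟩⟩ | ⟨⟨e⟩⟩⟩ | ⟨⟨k, hk⟩, -, ⟨e⟩⟩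
  · rw [d_congr e, d_starEdges (by simp) (by simp)]
    congr 1
    omega
  · rw [d_congr e, d_pathGraph_six]
  · rw [d_congr e, d_starEdges (by simp) (by simp)]
  · rw [d_congr e, d_starEdges (by simp) (by simp)]
    congr 1
    omega

/-! ### Induced connected subgraphs -/

theorem of_reachable_of_closed {H : SimpleGraph V} {P : V → Prop}
    (hP : ∀ x y, H.Adj x y → P x → P y) {x y : V} (h : H.Reachable x y) (hx : P x) : P y := by
  obtain ⟨p⟩ := h
  induction p with
  | nil => exact hx
  | cons hadj _ ih => exact ih (hP _ _ hadj hx)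

/-- If the edges leaving `W` inside `U` all start at the same vertex `w`, then connectedness passes
from `G[U]` to `G[W]`. -/
theorem connected_induce_of_gate {G : SimpleGraph V} {U W : Set V}
    (hU : (G.induce U).Connected) (hWU : W ⊆ U) {w : V} (hw : w ∈ W)
    (gate : ∀ x ∈ W, ∀ y ∈ U, y ∉ W → G.Adj x y → x = w) : (G.induce W).Connected := by
  have key : ∀ (x z : U), (G.induce U).Walk x z → z.1 = w → ∀ hx : x.1 ∈ W,
      (G.induce W).Reachable ⟨x, hx⟩ ⟨w, hw⟩ := by
    intro x z p
    induction p with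
    | nil =>
      rintro rfl hx
      rfl
    | @cons x y z hadj _ ih =>
      intro hz hx
      by_cases hy : y.1 ∈ W
      · have hadj' : (G.induce W).Adj ⟨x, hx⟩ ⟨y, hy⟩ := hadj
        exact hadj'.reachable.trans (ih hz hy)
      · have := gate x hx y y.2 hy hadj
        subst this
        rfl
  rw [SimpleGraph.connected_iff_exists_forall_reachable]
  refine ⟨⟨w, hw⟩, fun x => ?_⟩
  obtain ⟨p⟩ := hU.preconnected ⟨x, hWU x.2⟩ ⟨w, hWU hw⟩
  exact (key _ _ p rfl x.2).symm

theorem isSpider_of_connected {G : SimpleGraph V} {U : Finset V} {c : V}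
    (hU : (G.induce (U : Set V)).Connected) (hc : c ∈ U)
    (no_path : ∀ v ∈ U, ∀ a ∈ U, ∀ b ∈ U, v ≠ c → a ≠ c → b ≠ c → G.Adj v a → G.Adj v b → a = b) :
    IsSpider G U c := by
  refine ⟨hc, no_path, fun x hx => ?_⟩
  by_contra! hcon
  obtain ⟨hxU, hxc, hcx⟩ := mem_feet.1 hx
  have := of_reachable_of_closed (P := fun y : (U : Set V) => y.1 = x ∨ G.Adj x y) ?_
    (hU.preconnected ⟨x, hxU⟩ ⟨c, hc⟩) (Or.inl rfl)
  · rcases this with h | h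
    · exact hxc h.symm
    · exact hcx h.symm
  · rintro ⟨y, hy⟩ ⟨z, hz⟩ (hyz : G.Adj y z) (h : y = x ∨ G.Adj x y)
    change z = x ∨ G.Adj x z
    rcases h with rfl | h
    · exact Or.inr hyz
    · left
      have hzc : z ≠ c := by
        rintro rfl
        exact hcon y hy h hyz.symm
      have hyc : y ≠ c := by
        rintro rfl
        exact hcx h.symm
      exact no_path y hy z hz x hxU hyc hzc hxc hyz h.symm

/-! ### The extremal path on six vertices -/

/-- Attaching a pendant edge to the end `p 0` of a path on four vertices gives `P₆`. -/
theorem nonempty_iso_pathGraph_six [Fintype V] (hV : Fintype.card V = 6) {G : SimpleGraph V}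
    {v₀ v₁ : V} {p : Fin 4 → V} (hp : Function.Injective p) (h0 : ∀ i, p i ≠ v₀)
    (h1 : ∀ i, p i ≠ v₁) (hv0 : ∀ x, G.Adj v₀ x ↔ x = v₁)
    (hv1 : ∀ x, G.Adj v₁ x ↔ x = v₀ ∨ x = p 0)
    (hadj : ∀ i j, G.Adj (p i) (p j) ↔ i.val + 1 = j.val ∨ j.val + 1 = i.val) :
    Nonempty (G ≃g SimpleGraph.pathGraph 6) := by
  have h01 : G.Adj v₀ v₁ := (hv0 v₁).2 rfl
  let φ : Fin 6 → V := Fin.cons v₀ (Fin.cons v₁ p)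
  have hinj : Function.Injective φ := by
    rw [Fin.cons_injective_iff, Fin.cons_injective_iff]
    refine ⟨?_, ?_, hp⟩
    · rintro ⟨j, hj⟩
      induction j using Fin.cases with
      | zero => exact h01.ne' hj
      | succ j => exact h0 j hj
    · rintro ⟨j, hj⟩
      exact h1 j hj
  have hbij : Function.Bijective φ := by
    rw [Fintype.bijective_iff_injective_and_card]
    exact ⟨hinj, by simp [hV]⟩
  have e0 : φ 0 = v₀ := rfl
  have e1 : φ (Fin.succ 0) = v₁ := rfl
  have e2 : ∀ i, φ (Fin.succ (Fin.succ i)) = p i := fun _ => rfl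
  have key0 : ∀ j, G.Adj v₀ (φ j) ↔ j = Fin.succ 0 := fun j => by
    rw [hv0, ← e1, hinj.eq_iff]
  have key1 : ∀ j, G.Adj v₁ (φ j) ↔ j = 0 ∨ j = Fin.succ (Fin.succ 0) := fun j => by
    rw [hv1, ← e0, ← e2, hinj.eq_iff, hinj.eq_iff]
  have key : ∀ i j, G.Adj (φ i) (φ j) ↔ (SimpleGraph.pathGraph 6).Adj i j := by
    intro i j
    rw [SimpleGraph.pathGraph_adj]
    induction i using Fin.cases with
    | zero => rw [e0, key0, Fin.ext_iff]; simp; omega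
    | succ i =>
      induction i using Fin.cases with
      | zero => rw [e1, key1, Fin.ext_iff, Fin.ext_iff]; simp; omega
      | succ i =>
        induction j using Fin.cases with
        | zero => rw [G.adj_comm, e0, key0, Fin.ext_iff]; simp
        | succ j =>
          induction j using Fin.cases with
          | zero => rw [G.adj_comm, e1, key1, Fin.ext_iff, Fin.ext_iff]; simp
          | succ j => rw [e2, e2, hadj]; simp
  exact ⟨(⟨Equiv.ofBijective φ hbij, fun {x y} => key x y⟩ : SimpleGraph.pathGraph 6 ≃g G).symm⟩

/-- `K₂ ∗ K₂` is the path on four vertices, and it can be traversed from either end. -/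
theorem exists_path_of_iso {W : Type*} {H : SimpleGraph W} (e : H ≃g starEdges 2 1) {w x : W}
    (hw : ∀ y, H.Adj w y → y = x) :
    ∃ p : Fin 4 → W, Function.Injective p ∧ p 0 = w ∧
      ∀ i j, H.Adj (p i) (p j) ↔ i.val + 1 = j.val ∨ j.val + 1 = i.val := by
  let g : Fin 4 → Fin 2 ⊕ (Σ _ : Fin 1, Fin 2) := ![.inl 1, .inl 0, .inr ⟨0, 0⟩, .inr ⟨0, 1⟩]
  have hg : ∀ i j, (starEdges 2 1).Adj (g i) (g j) ↔ i.val + 1 = j.val ∨ j.val + 1 = i.val := by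
    intro i j
    fin_cases i <;> fin_cases j <;> simp [g, starEdges, cliqueStar]
  have hgi : Function.Injective g := by decide
  have hgs : ∀ y, ∃ i, g i = y := by decide
  have hadj : ∀ i j, H.Adj (e.symm (g i)) (e.symm (g j)) ↔
      i.val + 1 = j.val ∨ j.val + 1 = i.val := fun i j => by
    rw [e.symm.map_adj_iff, hg]
  obtain ⟨i, hi⟩ := hgs (e w)
  have hwi : w = e.symm (g i) := by rw [hi]; simp
  have hne : ∀ j k, H.Adj w (e.symm (g j)) → H.Adj w (e.symm (g k)) → j = k := fun j k h1 h2 =>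
    hgi (e.symm.injective ((hw _ h1).trans (hw _ h2).symm))
  have hi03 : i = 0 ∨ i = 3 := by
    rw [hwi] at hne
    simp only [hadj] at hne
    have : ∀ i : Fin 4, (∀ j k : Fin 4, (i.val + 1 = j.val ∨ j.val + 1 = i.val) →
        (i.val + 1 = k.val ∨ k.val + 1 = i.val) → j = k) → i = 0 ∨ i = 3 := by decide
    exact this i hne
  rcases hi03 with rfl | rfl
  · exact ⟨fun j => e.symm (g j), e.symm.injective.comp hgi, hwi.symm, hadj⟩
  · refine ⟨fun j => e.symm (g j.rev), e.symm.injective.comp (hgi.comp Fin.rev_injective),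
      hwi.symm, fun j k => ?_⟩
    rw [hadj, Fin.val_rev, Fin.val_rev]
    omega

/-! ### Pendant edges and twin leaves -/

/-- The nontrivial half of the theorem for a graph of order `n`: the bound, and the structure of the
graphs that attain it. -/
def BoundAt (n : ℕ) {V : Type u} (G : SimpleGraph V) : Prop :=
  d G ≤ maxCount n ∧
    (d G = maxCount n → IsF n G ∨ (n = 3 ∧ Nonempty (G ≃g (⊤ : SimpleGraph (Fin 3)))))

/-- The induction step for a graph with a pendant edge `v₀ v₁` attached to `v₂`. -/
theorem d_le_of_pendant [Fintype V] {n : ℕ} (hn : Fintype.card V = n) (h4 : 4 ≤ n)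
    {G : SimpleGraph V}
    (ih : ∀ U : Finset V, U.card < n → (G.induce (U : Set V)).Connected →
      BoundAt U.card (G.induce (U : Set V)))
    {v₀ v₁ v₂ : V} (h02 : v₀ ≠ v₂)
    (hv0 : ∀ x, G.Adj v₀ x ↔ x = v₁) (hv1 : ∀ x, G.Adj v₁ x ↔ x = v₀ ∨ x = v₂)
    (hc : (G.induce ({v₀, v₁}ᶜ : Set V)).Connected) :
    d G ≤ maxCount n ∧ (d G = maxCount n → IsF n G) := by
  classical
  have a01 : G.Adj v₀ v₁ := (hv0 v₁).2 rfl
  have a12 : G.Adj v₁ v₂ := (hv1 v₂).2 (Or.inr rfl)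
  set U : Finset V := {v₀, v₁}ᶜ with hUdef
  have hmU : ∀ x, x ∈ U ↔ x ≠ v₀ ∧ x ≠ v₁ := by intro x; simp [U]
  have h2U : v₂ ∈ U := (hmU _).2 ⟨h02.symm, a12.ne'⟩
  have hUc : (G.induce (U : Set V)).Connected := by
    have : ((U : Finset V) : Set V) = {v₀, v₁}ᶜ := by rw [hUdef]; push_cast; rfl
    rw [this]
    exact hc
  obtain ⟨k, rfl⟩ : ∃ k, n = k + 3 := ⟨n - 3, by omega⟩
  have hUcard : U.card = k + 1 := by
    rw [hUdef, Finset.card_compl, Finset.card_pair a01.ne, hn]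
    omega
  have ihU : dOn G U ≤ maxCount (k + 1) ∧ (dOn G U = maxCount (k + 1) →
      IsF (k + 1) (G.induce (U : Set V)) ∨
        (k + 1 = 3 ∧ Nonempty (G.induce (U : Set V) ≃g (⊤ : SimpleGraph (Fin 3))))) := by
    have := ih U (by omega) hUc
    rw [BoundAt, d_induce, hUcard] at this
    exact this
  set W := U.erase v₂ with hWdef
  have hmW : ∀ x, x ∈ W ↔ x ≠ v₂ ∧ x ≠ v₀ ∧ x ≠ v₁ := by
    intro x
    rw [hWdef, Finset.mem_erase, hmU]
  have hWU : W ⊆ U := Finset.erase_subset _ _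
  have h2W : insert v₂ W = U := Finset.insert_erase h2U
  have hWcard : W.card = k := by
    rw [hWdef, Finset.card_erase_of_mem h2U, hUcard]
    rfl
  have hfeet : W.filter (fun x => ¬ G.Adj v₂ x) = feet G U v₂ := by
    ext x
    simp only [mem_feet, Finset.mem_filter, hmW, hmU]
    tauto
  have huniv : insert v₀ (insert v₁ (insert v₂ W)) = Finset.univ := by
    ext x
    simp only [Finset.mem_insert, hmW, Finset.mem_univ, iff_true]
    tauto
  have hd : d G = 2 * dOn G U + 2 * dOn G W + dOn G (feet G U v₂) := by
    rw [d_eq_dOn_univ, ← huniv, dOn_pendant a01.ne h02 a12.ne (by simp [hmW]) (by simp [hmW])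
      (by simp [hmW]) a01 a12 (fun h => a12.ne' ((hv0 _).1 h))
      (fun x hx h => ((hmW x).1 hx).2.2 ((hv0 _).1 h))
      (fun x hx h => by have := (hmW x).1 hx; have := (hv1 _).1 h; tauto), h2W, hfeet]
  have hfeetW : feet G U v₂ ⊆ W := hfeet ▸ Finset.filter_subset _ _
  rw [hd, maxCount]
  by_cases hno : ∀ v ∈ W, ∀ a ∈ W, ∀ b ∈ W, G.Adj v a → G.Adj v b → a = b
  · have hs : IsSpider G U v₂ := by
      refine isSpider_of_connected hUc h2U fun v hv a ha b hb h1 h2 h3 => hno v ?_ a ?_ b ?_ <;>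
        exact Finset.mem_erase.2 ⟨‹_›, ‹_›⟩
    have hlt := hs.two_mul_card_feet_lt
    rw [dOn_eq_of_no_path G W hno, dOn_eq_of_no_path G (feet G U v₂) (fun v hv a ha b hb =>
      hno v (hfeetW hv) a (hfeetW ha) b (hfeetW hb)), hWcard]
    have hpow : 2 ^ (feet G U v₂).card ≤ 2 ^ (k / 2) :=
      Nat.pow_le_pow_right two_pos (by omega)
    refine ⟨by omega, fun heq => ?_⟩
    have hfc : (feet G U v₂).card = k / 2 := Nat.pow_right_injective le_rfl (by grind)
    -- Restoring the pendant edge adds the single foot `v₀`, with knee `v₁`.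
    have hfu : feet G Finset.univ v₂ = insert v₀ (feet G U v₂) := by
      ext x
      simp only [mem_feet, Finset.mem_insert, hmU, Finset.mem_univ, true_and]
      constructor
      · rintro ⟨h1, h2⟩
        by_cases hx : x = v₀
        · exact Or.inl hx
        · exact Or.inr ⟨⟨hx, fun h => h2 (h ▸ a12.symm)⟩, h1, h2⟩
      · rintro (rfl | ⟨-, h⟩)
        · exact ⟨h02, fun h => a12.ne' ((hv0 _).1 h.symm)⟩
        · exact h
    refine isF_of_isSpider (c := v₂) hn ⟨Finset.mem_univ _, ?_, ?_⟩ ?_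
    · intro v _ a _ b _ h1 h2 h3 h4 h5
      by_cases hv0' : v = v₀
      · subst hv0'
        rw [hv0] at h4 h5
        rw [h4, h5]
      by_cases hv1' : v = v₁
      · subst hv1'
        rw [hv1] at h4 h5
        rw [h4.resolve_right h2, h5.resolve_right h3]
      have hmem : ∀ x, x ≠ v₂ → G.Adj v x → x ∈ W := by
        intro x hx hvx
        refine (hmW x).2 ⟨hx, ?_, ?_⟩
        · rintro rfl
          exact hv1' ((hv0 _).1 hvx.symm)
        · rintro rfl
          rcases (hv1 _).1 hvx.symm with h | h
          · exact hv0' h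
          · exact h1 h
      exact hno v ((hmW v).2 ⟨h1, hv0', hv1'⟩) a (hmem a h2 h4) b (hmem b h3 h5) h4 h5
    · intro x hx
      rw [hfu, Finset.mem_insert] at hx
      rcases hx with rfl | hx
      · exact ⟨v₁, Finset.mem_univ _, a01, a12.symm⟩
      · obtain ⟨a, -, ha⟩ := hs.exists_knee x hx
        exact ⟨a, Finset.mem_univ _, ha⟩
    · rw [hfu, Finset.card_insert_of_notMem (by simp [mem_feet, hmU]), hfc]
      omega
  · push Not at hno
    obtain ⟨v, hv, a, ha, b, hb, hva, hvb, hab⟩ := hno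
    have h8 := eight_mul_dOn_le_of_path hv ha hb hva hvb hab
    rw [hWcard] at h8
    have hk3 : 3 ≤ k := by
      have h3 : ({v, a, b} : Finset V).card = 3 :=
        Finset.card_eq_three.2 ⟨v, a, b, hva.ne, hvb.ne, hab, rfl⟩
      have := Finset.card_le_card (show ({v, a, b} : Finset V) ⊆ W by grind)
      omega
    have hdeg := card_feet_add G h2U
    have hY := dOn_le G (feet G U v₂)
    have hpos : 0 < 2 ^ (k / 2) := by positivity
    obtain ⟨w, hwU, hw⟩ : ∃ w ∈ U, G.Adj v₂ w := by
      by_contra! hcon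
      have := of_reachable_of_closed (P := fun y : (U : Set V) => y.1 = v₂) ?_
        (hUc.preconnected ⟨v₂, h2U⟩ ⟨v, hWU hv⟩) rfl
      · exact ((hmW v).1 hv).1 this
      · rintro ⟨x, hx⟩ ⟨y, hy⟩ (hxy : G.Adj x y) (rfl : x = v₂)
        exact absurd hxy (hcon y hy)
    by_cases huniq : ∀ y ∈ U, G.Adj v₂ y → y = w
    · have hA : (U.filter fun x => G.Adj v₂ x) = {w} := by
        ext x
        simp only [Finset.mem_filter, Finset.mem_singleton]
        exact ⟨fun h => huniq x h.1 h.2, by rintro rfl; exact ⟨hwU, hw⟩⟩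
      rw [hA, Finset.card_singleton] at hdeg
      have hwW : w ∈ W := Finset.mem_erase.2 ⟨hw.ne', hwU⟩
      have hWc : (G.induce (W : Set V)).Connected := by
        refine connected_induce_of_gate (w := w) hUc (Finset.coe_subset.2 hWU) hwW ?_
        intro x hx y hy hyW hxy
        have : y = v₂ := by
          by_contra hne
          exact hyW (Finset.mem_coe.2 (Finset.mem_erase.2 ⟨hne, hy⟩))
        subst this
        exact huniq x (hWU hx) hxy.symm
      have ihW := (ih W (by omega) hWc).1
      rw [d_induce, hWcard] at ihW
      have hfc : (feet G U v₂).card = k - 1 := by omega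
      rw [hfc] at hY
      -- For `k ≥ 4` the bound is strict; for `k = 3` equality is possible and `U` is extremal.
      rcases Nat.lt_or_ge 3 k with hk | hk
      · obtain ⟨j, rfl⟩ : ∃ j, k = j + 4 := ⟨k - 4, by omega⟩
        have h1 := two_mul_maxCount_lt j
        have h2 : 2 ^ (j + 4) = 2 * 2 ^ (j + 3) := by ring
        rw [show j + 4 - 1 = j + 3 from rfl] at hY
        omega
      · obtain rfl : k = 3 := by omega
        have hm3 : maxCount 3 = 7 := rfl
        have hU4 : dOn G U ≤ maxCount 4 := ihU.1
        norm_num at hY ⊢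
        refine ⟨by omega, fun heq => ?_⟩
        have h13 := ihU.2 (by grind)
        obtain ⟨e⟩ : Nonempty (G.induce (U : Set V) ≃g starEdges 2 1) := by
          rcases h13 with (⟨h, -⟩ | ⟨h, -⟩ | ⟨-, -, h⟩) | ⟨h, -⟩
          · exact absurd h (by decide)
          · omega
          · exact h
          · omega
        obtain ⟨p, hp, hp0, hadj⟩ := exists_path_of_iso e (w := ⟨v₂, h2U⟩) (x := ⟨w, hwU⟩)
          (fun y hy => Subtype.ext (huniq y y.2 hy))
        have hp0' : (p 0).1 = v₂ := by rw [hp0]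
        exact Or.inr (Or.inl ⟨rfl, Or.inl (nonempty_iso_pathGraph_six hn
          (p := fun i => (p i).1) (Subtype.val_injective.comp hp)
          (fun i => ((hmU _).1 (p i).2).1) (fun i => ((hmU _).1 (p i).2).2) hv0
          (by rw [hp0']; exact hv1) hadj)⟩)
    · push Not at huniq
      obtain ⟨y, hyU, hy, hyw⟩ := huniq
      have hA : 2 ≤ (U.filter fun x => G.Adj v₂ x).card := by
        rw [← Finset.card_pair hyw]
        exact Finset.card_le_card (by grind)
      have h2 : 2 ^ (feet G U v₂).card ≤ 2 ^ (k - 2) :=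
        Nat.pow_le_pow_right two_pos (by omega)
      have h3 : 2 ^ k = 4 * 2 ^ (k - 2) := by
        rw [show 4 = 2 ^ 2 by rfl, ← pow_add]
        congr 1
        omega
      omega

/-- A graph of order at least four with twin leaves is not extremal. -/
theorem d_lt_of_twins [Fintype V] {n : ℕ} (hn : Fintype.card V = n) (h4 : 4 ≤ n)
    (ih : ∀ (G : SimpleGraph V) (U : Finset V), U.card < n → (G.induce (U : Set V)).Connected →
      BoundAt U.card (G.induce (U : Set V)))
    {G : SimpleGraph V} (hG : G.Connected) {l₁ l₂ v : V} (hl : l₁ ≠ l₂)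
    (h1 : ∀ x, G.Adj l₁ x ↔ x = v) (h2 : ∀ x, G.Adj l₂ x ↔ x = v) : d G < maxCount n := by
  classical
  have a1 : G.Adj l₁ v := (h1 v).2 rfl
  have a2 : G.Adj l₂ v := (h2 v).2 rfl
  obtain ⟨w, hw, hw1, hw2⟩ : ∃ w, G.Adj v w ∧ w ≠ l₁ ∧ w ≠ l₂ := by
    by_contra! hcon
    have hall : ∀ x, x = v ∨ x = l₁ ∨ x = l₂ := fun x => by
      refine of_reachable_of_closed (P := fun x => x = v ∨ x = l₁ ∨ x = l₂) ?_
        (hG.preconnected v x) (Or.inl rfl)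
      rintro x y hxy (rfl | rfl | rfl)
      · have := hcon y hxy
        tauto
      · exact Or.inl ((h1 _).1 hxy)
      · exact Or.inl ((h2 _).1 hxy)
    have h3 : (Finset.univ : Finset V).card ≤ ({v, l₁, l₂} : Finset V).card :=
      Finset.card_le_card fun x _ => by simpa using hall x
    have := Finset.card_le_three (a := v) (b := l₁) (c := l₂)
    rw [Finset.card_univ] at h3
    omega
  -- `H` arises from `G` by replacing the edge `l₂ v` by `l₂ l₁`.
  let H : SimpleGraph V :=
    { Adj := fun x y => (G.Adj x y ∧ x ≠ l₂ ∧ y ≠ l₂) ∨ (x = l₁ ∧ y = l₂) ∨ (x = l₂ ∧ y = l₁)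
      symm := ⟨fun x y h => by
        rcases h with h | h | h
        · exact Or.inl ⟨h.1.symm, h.2.2, h.2.1⟩
        · exact Or.inr (Or.inr ⟨h.2, h.1⟩)
        · exact Or.inr (Or.inl ⟨h.2, h.1⟩)⟩
      loopless := ⟨fun x h => by
        rcases h with h | h | h
        · exact G.irrefl h.1
        · exact hl (h.1.symm.trans h.2)
        · exact hl (h.2.symm.trans h.1)⟩ }
  have hH : ∀ x y, H.Adj x y ↔
    (G.Adj x y ∧ x ≠ l₂ ∧ y ≠ l₂) ∨ (x = l₁ ∧ y = l₂) ∨ (x = l₂ ∧ y = l₁) := fun _ _ => Iff.rfl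
  -- Every dissociation set of `G` is one of `H`, and `{v, w, l₂}` is one of `H` only.
  have hlt : d G < d H := by
    rw [d_eq_dOn_univ, d_eq_dOn_univ, dOn, dOn]
    refine Finset.card_lt_card ⟨fun S hS => ?_, fun hsub => ?_⟩
    · rw [Finset.mem_filter] at hS ⊢
      refine ⟨hS.1, fun x hx a ha b hb hxa hxb => ?_⟩
      have hD := hS.2
      have hv : l₁ ∈ S → l₂ ∈ S → v ∉ S := fun hs1 hs2 hvS =>
        hl (hD v hvS l₁ hs1 l₂ hs2 a1.symm a2.symm)
      rcases hxa with ⟨hxa, hx2, ha2⟩ | ⟨rfl, rfl⟩ | ⟨rfl, rfl⟩ <;>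
        rcases hxb with ⟨hxb, hx2', hb2⟩ | ⟨h, rfl⟩ | ⟨h, rfl⟩
      · exact hD x hx a ha b hb hxa hxb
      · subst h
        exact absurd ((h1 a).1 hxa ▸ ha) (hv hx hb)
      · exact absurd h hx2
      · exact absurd ((h1 b).1 hxb ▸ hb) (hv hx ha)
      · rfl
      · exact absurd h hl
      · exact absurd rfl hx2'
      · exact absurd h.symm hl
      · rfl
    · have hmem : ({v, w, l₂} : Finset V) ∈ Finset.univ.powerset.filter (Diss H) := by
        rw [Finset.mem_filter]
        refine ⟨by simp, fun x hx a ha b hb => ?_⟩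
        simp only [Finset.mem_insert, Finset.mem_singleton] at hx ha hb
        simp only [hH]
        have := G.irrefl (v := v)
        have := G.irrefl (v := w)
        have := a1.ne
        have := a2.ne
        have := hw.ne
        grind
      have := (Finset.mem_filter.1 (hsub hmem)).2 v (by simp) w (by simp) l₂ (by simp) hw a2.symm
      exact hw2 this
  refine hlt.trans_le (d_le_of_pendant hn h4 (ih H) (v₀ := l₂) (v₁ := l₁) (v₂ := v) a2.ne ?_ ?_ ?_).1
  · intro x
    rw [hH]
    grind
  · intro x
    rw [hH]
    have := a2.ne
    grind
  · have hGc : (G.induce ({l₂, l₁}ᶜ : Set V)).Connected := by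
      refine connected_induce_of_gate (U := Set.univ) (w := v) ?_ (Set.subset_univ _) ?_ ?_
      · exact (SimpleGraph.induceUnivIso G).connected_iff.2 hG
      · simp [a1.ne', a2.ne']
      · intro x _ y _ hy hxy
        rw [Set.mem_compl_iff, not_not, Set.mem_insert_iff, Set.mem_singleton_iff] at hy
        rcases hy with rfl | rfl
        · exact (h2 x).1 hxy.symm
        · exact (h1 x).1 hxy.symm
    have : H.induce ({l₂, l₁}ᶜ : Set V) = G.induce ({l₂, l₁}ᶜ : Set V) := by
      ext ⟨x, hx⟩ ⟨y, hy⟩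
      simp only [Set.mem_compl_iff, Set.mem_insert_iff, Set.mem_singleton_iff] at hx hy
      change H.Adj x y ↔ G.Adj x y
      rw [hH]
      tauto
    rw [this]
    exact hGc

/-! ### Trees and spanning trees -/

/-- In a tree rooted at `r`, a vertex has only one neighbour closer to `r`. -/
theorem isTree_parent_unique {T : SimpleGraph V} (hT : T.IsTree) (r : V) {x a b : V}
    (ha : T.Adj a x) (hb : T.Adj b x) (hda : T.dist r x = T.dist r a + 1)
    (hdb : T.dist r x = T.dist r b + 1) : a = b := by
  obtain ⟨p, hp⟩ := (hT.connected.preconnected r a).exists_walk_length_eq_dist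
  obtain ⟨q, hq⟩ := (hT.connected.preconnected r b).exists_walk_length_eq_dist
  have h1 : (p.concat ha).IsPath :=
    SimpleGraph.Walk.isPath_of_length_eq_dist _ (by rw [SimpleGraph.Walk.length_concat]; omega)
  have h2 : (q.concat hb).IsPath :=
    SimpleGraph.Walk.isPath_of_length_eq_dist _ (by rw [SimpleGraph.Walk.length_concat]; omega)
  have h3 := congrArg Subtype.val
    ((hT.isAcyclic.subsingleton_path _ _).elim ⟨_, h1⟩ ⟨_, h2⟩)
  have h4 := congrArg SimpleGraph.Walk.penultimate h3
  simpa using h4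

/-- A tree with at least three vertices has twin leaves or a pendant edge: take a vertex `v₀` farthest
from a root and its parent `v₁`, all of whose children are leaves. -/
theorem isTree_twins_or_pendant [Fintype V] {T : SimpleGraph V} (hT : T.IsTree)
    (h3 : 3 ≤ Fintype.card V) :
    (∃ l₁ l₂ v, l₁ ≠ l₂ ∧ (∀ x, T.Adj l₁ x ↔ x = v) ∧ ∀ x, T.Adj l₂ x ↔ x = v) ∨
    ∃ v₀ v₁ v₂, v₀ ≠ v₂ ∧ (∀ x, T.Adj v₀ x ↔ x = v₁) ∧ ∀ x, T.Adj v₁ x ↔ x = v₀ ∨ x = v₂ := by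
  classical
  obtain ⟨r⟩ := hT.connected.nonempty
  obtain ⟨v₀, -, hmax⟩ := Finset.exists_max_image Finset.univ (T.dist r) ⟨r, Finset.mem_univ r⟩
  have hnt : Nontrivial V := Fintype.one_lt_card_iff_nontrivial.1 (by omega)
  have hnbr : ∀ x, ∃ y, T.Adj x y := fun x => hT.connected.preconnected.exists_adj_of_nontrivial x
  have hleaf : ∀ x y, T.dist r x = T.dist r v₀ → T.Adj x y → ∀ z, T.Adj x z ↔ z = y := by
    have hup : ∀ x y, T.dist r x = T.dist r v₀ → T.Adj x y → T.dist r x = T.dist r y + 1 := by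
      intro x y hx hxy
      have := hT.dist_eq_dist_add_one_of_adj r hxy
      have := hmax y (Finset.mem_univ y)
      omega
    intro x y hx hxy z
    refine ⟨fun hxz => ?_, by rintro rfl; exact hxy⟩
    exact isTree_parent_unique hT r hxz.symm hxy.symm (hup x z hx hxz) (hup x y hx hxy)
  obtain ⟨v₁, h01⟩ := hnbr v₀
  have hd1 : T.dist r v₀ = T.dist r v₁ + 1 := by
    have := hT.dist_eq_dist_add_one_of_adj r h01
    have := hmax v₁ (Finset.mem_univ _)
    omega
  by_cases htw : ∃ l, l ≠ v₀ ∧ T.Adj v₁ l ∧ T.dist r l = T.dist r v₀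
  · obtain ⟨l, hl, hadj, hdl⟩ := htw
    exact Or.inl ⟨l, v₀, v₁, hl, hleaf l v₁ hdl hadj.symm, hleaf v₀ v₁ rfl h01⟩
  · push Not at htw
    obtain ⟨v₂, h12, h20⟩ : ∃ v₂, T.Adj v₁ v₂ ∧ v₂ ≠ v₀ := by
      by_contra! hcon
      have hall : ∀ x, x = v₀ ∨ x = v₁ := fun x => by
        refine of_reachable_of_closed (P := fun x => x = v₀ ∨ x = v₁) ?_
          (hT.connected.preconnected v₀ x) (Or.inl rfl)
        rintro x y hxy (rfl | rfl)
        · exact Or.inr ((hleaf _ v₁ rfl h01 y).1 hxy)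
        · exact Or.inl (hcon y hxy)
      have h3' : (Finset.univ : Finset V).card ≤ ({v₀, v₁} : Finset V).card :=
        Finset.card_le_card fun x _ => by simpa using hall x
      have := Finset.card_le_two (a := v₀) (b := v₁)
      rw [Finset.card_univ] at h3'
      omega
    have hup : ∀ y, T.Adj v₁ y → y ≠ v₀ → T.dist r v₁ = T.dist r y + 1 := by
      intro y hy hy0
      have := hT.dist_eq_dist_add_one_of_adj r hy
      have := htw y hy0 hy
      omega
    refine Or.inr ⟨v₀, v₁, v₂, h20.symm, hleaf v₀ v₁ rfl h01, fun x => ⟨fun hx => ?_, ?_⟩⟩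
    · by_cases hx0 : x = v₀
      · exact Or.inl hx0
      · exact Or.inr (isTree_parent_unique hT r hx.symm h12.symm (hup x hx hx0) (hup v₂ h12 h20))
    · rintro (rfl | rfl)
      · exact h01.symm
      · exact h12

theorem d_le_of_isTree [Fintype V] {n : ℕ} (hn : Fintype.card V = n) (h4 : 4 ≤ n)
    (ih : ∀ (G : SimpleGraph V) (U : Finset V), U.card < n → (G.induce (U : Set V)).Connected →
      BoundAt U.card (G.induce (U : Set V)))
    {T : SimpleGraph V} (hT : T.IsTree) :
    d T ≤ maxCount n ∧ (d T = maxCount n → IsF n T) := by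
  rcases isTree_twins_or_pendant hT (by omega) with
    ⟨l₁, l₂, v, hl, h1, h2⟩ | ⟨v₀, v₁, v₂, h02, hv0, hv1⟩
  · have := d_lt_of_twins hn h4 ih hT.connected hl h1 h2
    exact ⟨this.le, fun h => absurd h this.ne⟩
  · refine d_le_of_pendant hn h4 (ih T) h02 hv0 hv1 ?_
    have a12 : T.Adj v₁ v₂ := (hv1 v₂).2 (Or.inr rfl)
    refine connected_induce_of_gate (U := Set.univ) (w := v₂) ?_ (Set.subset_univ _) ?_ ?_
    · exact (SimpleGraph.induceUnivIso T).connected_iff.2 hT.connected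
    · simp [h02.symm, a12.ne']
    · intro x hx y _ hy hxy
      rw [Set.mem_compl_iff, not_not, Set.mem_insert_iff, Set.mem_singleton_iff] at hy
      rw [Set.mem_compl_iff, Set.mem_insert_iff, Set.mem_singleton_iff, not_or] at hx
      rcases hy with rfl | rfl
      · exact absurd ((hv0 x).1 hxy.symm) hx.2
      · exact ((hv1 x).1 hxy.symm).resolve_left hx.1

theorem d_le_of_le [Fintype V] {T G : SimpleGraph V} (h : T ≤ G) : d G ≤ d T := by
  classical
  rw [d_eq_dOn_univ, d_eq_dOn_univ, dOn, dOn]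
  refine Finset.card_le_card fun S hS => ?_
  rw [Finset.mem_filter] at hS ⊢
  exact ⟨hS.1, fun v hv a ha b hb h1 h2 => hS.2 v hv a ha b hb (h h1) (h h2)⟩

/-- An additional edge `uv` destroys the dissociation set `{u, v, w}`, for every vertex `w` adjacent
to `u` but not to `v`. -/
theorem d_lt_of_le [Fintype V] {T G : SimpleGraph V} (h : T ≤ G) {u v w : V} (huv : G.Adj u v)
    (huv' : ¬ T.Adj u v) (huw : T.Adj u w) (hvw : ¬ T.Adj v w) : d G < d T := by
  classical
  rw [d_eq_dOn_univ, d_eq_dOn_univ, dOn, dOn]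
  refine Finset.card_lt_card ⟨fun S hS => ?_, fun hsub => ?_⟩
  · rw [Finset.mem_filter] at hS ⊢
    exact ⟨hS.1, fun v hv a ha b hb h1 h2 => hS.2 v hv a ha b hb (h h1) (h h2)⟩
  · have hmem : ({u, v, w} : Finset V) ∈ Finset.univ.powerset.filter (Diss T) := by
      rw [Finset.mem_filter]
      refine ⟨by simp, fun x hx a ha b hb => ?_⟩
      simp only [Finset.mem_insert, Finset.mem_singleton] at hx ha hb
      have := T.irrefl (v := u)
      have := T.irrefl (v := v)
      have := T.irrefl (v := w)
      have := T.adj_comm u v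
      have := T.adj_comm v w
      have := T.adj_comm u w
      grind
    have := (Finset.mem_filter.1 (hsub hmem)).2 u (by simp) v (by simp) w (by simp) huv (h huw)
    exact huv' (this ▸ huw)

/-- Distinct vertices of a tree have at most one common neighbour. -/
theorem isTree_common_neighbor_unique {T : SimpleGraph V} (hT : T.IsTree) {u v a b : V} (huv : u ≠ v)
    (hua : T.Adj u a) (hub : T.Adj u b) (hva : T.Adj v a) (hvb : T.Adj v b) : a = b := by
  have key : ∀ c (hc : T.Adj u c) (hc' : T.Adj c v),
      (SimpleGraph.Walk.cons hc (SimpleGraph.Walk.cons hc' SimpleGraph.Walk.nil)).IsPath := by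
    intro c hc hc'
    simp [SimpleGraph.Walk.isPath_def, hc.ne, hc'.ne, huv]
  have h := congrArg Subtype.val
    ((hT.isAcyclic.subsingleton_path _ _).elim
    ⟨_, key a hua hva.symm⟩ ⟨_, key b hub hvb.symm⟩)
  have h' := congrArg SimpleGraph.Walk.snd h
  simpa using h'

/-! ### The induction -/

/-- Every connected graph of order at most three is extremal. -/
theorem extremal_of_card_le_three [Fintype V] {n : ℕ} (hn : Fintype.card V = n) (h3 : n ≤ 3)
    {G : SimpleGraph V} (hG : G.Connected) :
    IsF n G ∨ (n = 3 ∧ Nonempty (G ≃g (⊤ : SimpleGraph (Fin 3)))) := by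
  classical
  have hs : ∀ c, IsSpider G Finset.univ c := by
    intro c
    refine isSpider_of_connected ?_ (Finset.mem_univ _) ?_
    · rw [Finset.coe_univ]
      exact (SimpleGraph.induceUnivIso G).connected_iff.2 hG
    · intro v _ a _ b _ h1 h2 h3 h4 h5
      by_contra hab
      have hc : ({c, v, a, b} : Finset V).card = 4 := by
        rw [Finset.card_eq_succ]
        exact ⟨c, {v, a, b}, by grind, rfl,
          Finset.card_eq_three.2 ⟨v, a, b, h4.ne, h5.ne, hab, rfl⟩⟩
      have := Finset.card_le_univ ({c, v, a, b} : Finset V)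
      omega
  have hlt : ∀ c, 2 * (feet G Finset.univ c).card < n := fun c => by
    have := (hs c).two_mul_card_feet_lt
    rwa [Finset.card_univ, hn] at this
  obtain ⟨c⟩ := hG.nonempty
  by_cases hn3 : n = 3
  · by_cases hx : ∃ c x, x ≠ c ∧ ¬ G.Adj c x
    · obtain ⟨c, x, hx⟩ := hx
      have h0 : 0 < (feet G Finset.univ c).card :=
        Finset.card_pos.2 ⟨x, mem_feet.2 ⟨Finset.mem_univ _, hx⟩⟩
      have := hlt c
      exact Or.inl (isF_of_isSpider hn (hs c) (by omega))
    · push Not at hx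
      refine Or.inr ⟨hn3, ?_⟩
      let e : V ≃ Fin 3 := Fintype.equivFinOfCardEq (hn.trans hn3)
      exact ⟨⟨e, fun {a b} => by
        simp only [SimpleGraph.top_adj, ne_eq, e.injective.eq_iff]
        exact ⟨fun h => hx a b (Ne.symm h), fun h => h.ne⟩⟩⟩
  · have := hlt c
    exact Or.inl (isF_of_isSpider hn (hs c) (by omega))

theorem d_top_three : d (⊤ : SimpleGraph (Fin 3)) = maxCount 3 := by
  classical
  have : (Finset.univ.powerset.filter fun S : Finset (Fin 3) => ∀ v ∈ S, ∀ a ∈ S, ∀ b ∈ S,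
      v ≠ a → v ≠ b → a = b).card = 7 := by
    decide +kernel
  rw [d_eq_dOn_univ, dOn, show maxCount 3 = 7 from rfl, ← this]
  congr 1
  ext S
  simp only [Finset.mem_filter, Diss, SimpleGraph.top_adj]

theorem d_of_extremal [Fintype V] {G : SimpleGraph V} {n : ℕ}
    (hn : Fintype.card V = n) (hn0 : 0 < n)
    (h : IsF n G ∨ (n = 3 ∧ Nonempty (G ≃g (⊤ : SimpleGraph (Fin 3))))) : d G = maxCount n := by
  rcases h with h | ⟨rfl, ⟨e⟩⟩
  · exact d_of_isF hn hn0 h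
  · rw [d_congr e, d_top_three]

theorem boundAt (n : ℕ) : ∀ {V : Type u} [Fintype V], Fintype.card V = n →
    ∀ {G : SimpleGraph V}, G.Connected → BoundAt n G := by
  induction n using Nat.strong_induction_on with
  | _ n ih =>
  intro V _ hn G hG
  classical
  have hn0 : 0 < n := by
    have := hG.nonempty
    exact hn ▸ Fintype.card_pos
  rcases Nat.lt_or_ge 3 n with h4 | h3
  · have ih' : ∀ (G : SimpleGraph V) (U : Finset V), U.card < n →
        (G.induce (U : Set V)).Connected → BoundAt U.card (G.induce (U : Set V)) :=
      fun G U hU hc => ih U.card hU (by simp) hc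
    obtain ⟨T, hTG, hT⟩ := hG.exists_isTree_le
    obtain ⟨hle, heq⟩ := d_le_of_isTree hn h4 ih' hT
    refine ⟨(d_le_of_le hTG).trans hle, fun h => Or.inl ?_⟩
    have hTd : d T = maxCount n := le_antisymm hle (h ▸ d_le_of_le hTG)
    -- An edge `uv` of `G` outside `T` makes `u` and `v` twin leaves of `T`, which is extremal.
    have hGT : G = T := by
      refine le_antisymm (fun u v huv => ?_) hTG
      by_contra huv'
      have hnt : Nontrivial V := Fintype.one_lt_card_iff_nontrivial.1 (by omega)
      obtain ⟨w, hw⟩ := hT.connected.preconnected.exists_adj_of_nontrivial u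
      have h1 : ∀ x, T.Adj u x → T.Adj v x := fun x hx => by
        by_contra hvx
        have := d_lt_of_le hTG huv huv' hx hvx
        omega
      have h2 : ∀ x, T.Adj v x → T.Adj u x := fun x hx => by
        by_contra hux
        have := d_lt_of_le hTG huv.symm (fun h => huv' h.symm) hx hux
        omega
      have := d_lt_of_twins hn h4 ih' hT.connected huv.ne (v := w)
        (fun x => ⟨fun hx => isTree_common_neighbor_unique hT huv.ne hx hw (h1 x hx) (h1 w hw),
          by rintro rfl; exact hw⟩)
        (fun x => ⟨fun hx => isTree_common_neighbor_unique hT huv.ne (h2 x hx) hw hx (h1 w hw),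
          by rintro rfl; exact h1 _ hw⟩)
      omega
    rw [hGT]
    exact heq hTd
  · have h := extremal_of_card_le_three hn h3 hG
    exact ⟨(d_of_extremal hn hn0 h).le, fun _ => h⟩

end Dissociation

/-- Among connected graphs of order `n`, the number of dissociation sets is at most `f n`,
with equality exactly for `F_n` and, if `n = 3`, also for the triangle `K_3`. -/
theorem theorem3p2 {V : Type*} [Fintype V] (n : ℕ) (hn : Fintype.card V = n)
    (G : SimpleGraph V) (hG : G.Connected) :
    (Dissociation.d G : ℚ) ≤ Dissociation.f n ∧
      ((Dissociation.d G : ℚ) = Dissociation.f n ↔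
        Dissociation.IsF n G ∨
          (n = 3 ∧ Nonempty (G ≃g (⊤ : SimpleGraph (Fin 3))))) := by
  have hn0 : 0 < n := by
    have := hG.nonempty
    exact hn ▸ Fintype.card_pos
  obtain ⟨hle, heq⟩ := Dissociation.boundAt n hn hG
  rw [← Dissociation.maxCount_eq_f hn0]
  norm_cast
  exact ⟨hle, heq, Dissociation.d_of_extremal hn hn0⟩
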